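/- Let $0\le u<\kappa$ be integers, $n=2^\kappa-2^u$, $k=n-\kappa$ and $W=\mathbb F_2^\kappa$. A coset code of size $(n,\kappa)$ consists of a $\kappa\times n$ matrix $G$ and a $k\times n$ matrix $G'$ over $\mathbb F_2$ such that the $n$ rows of the stacked matrix $\begin{bmatrix}G'\\G\end{bmatrix}$ are linearly independent; repeated columns and zero columns of $G$ are allowed. Over the binary erasure wiretap channel (BEWC) with erasure probability $\epsilon$, a uniformly distributed message $M\in\mathbb F_2^k$ and an independent, uniformly distributed $M'\in\mathbb F_2^\kappa$ are encoded as $X=[M\ M']\begin{bmatrix}G'\\G\end{bmatrix}$, and the eavesdropper receives $Z\in\{0,1,?\}^n$, which arises from $X$ by erasing each bit independently with probability $\epsilon$. Let $$\lambda(\epsilon)=\sum_{m,z}\Big(\frac{p_{MZ}(m,z)}{p_M(m)p_Z(z)}-1\Big)^2p_M(m)p_Z(z)$$ be the $\chi^2$ divergence between $p_{MZ}$ and $p_Mp_Z$ (terms with $p_Z(z)=0$ count as $0$), and let $\sum_z\max_m p_{MZ}(m,z)$ be the probability that the eavesdropper's maximum likelihood (ML) decoder recovers $M$. The code definition vector $q\in\mathbb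 R^W$ of a code has as its entry $q_v$ the fraction of the columns of $G$ that are equal to $v$. For a proper subspace $U$ of $W$ let $\check q^{[U]}_v=0$ for $v\in U$ and $\check q^{[U]}_v=1/(2^\kappa-2^{\dim U})$ for $v\notin U$; a code with code definition vector $\check q^{[U]}$ is called a subspace exclusion code. Let $\check q^{\{d\}}=\check q^{[U_d]}$, where $U_d$ is the set of vectors of $W$ whose coordinates after the first $d$ vanish, and let $\bar q_v=1/(2^\kappa-1)$ for $v\neq0$, $\bar q_0=0$. Let $|\cdot|$ be the Euclidean norm. 1. For every subspace $U$ of $W$ of dimension $u$ there is a coset code of size $(n,\kappa)$ with code definition vector $\check q^{[U]}$, and every such code is optimal for its size as a secrecy code over the BEWC: for every $\epsilon\in[0,1]$, neither its $\chi^2$ divergence $\lambda(\epsilon)$ nor the eavesdropper's probability of successful ML decoding exceeds that of any coset code of size $(n,\kappa)$. 2. Let $q\in\mathbb R^W$ satisfy $q_0=0$, $q_v\ge0$ for all $v$, $\sum_vq_v=1$ and the radius constraint $|q-\bar q|=|\check q^{\{u\}}-\bar q|$, and let $q$ be realizable at blocklength $n$, that is, $nq_v$ is a nonnegative integer for every $v$.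 Then $q$ satisfies the minimum-distance constraint $$|q-\check q^{[S]}|\ \ge\ |\check q^{\{u\}}-\check q^{\{\kappa-1\}}|\qquad\text{for every subspace }S\subseteq W\text{ with }\dim S=\kappa-1 .$$ -/

import Mathlib

noncomputable section

/-- Binary vectors of length `d`; for `d = κ` this is the global space `W`, in which the columns
of a generator matrix lie. -/
abbrev BVec (d : ℕ) : Type := Fin d → ZMod 2

/-- A coset code of blocklength `n` for messages of `k` bits, with a base code of dimension
`κ = n - k`: a `κ × n` generator matrix `G` of the base code and a `k × n` auxiliary generator
matrix `G'` such that the rows of the stacked `n × n` matrix `[G'; G]` are linearly independent. -/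
structure CosetCode (k κ n : ℕ) where
  G : Matrix (Fin κ) (Fin n) (ZMod 2)
  G' : Matrix (Fin k) (Fin n) (ZMod 2)
  size : k + κ = n
  linInd : LinearIndependent (ZMod 2) (fun i => Matrix.fromRows G' G i)

/-- The codeword `x = [m m'] [G'; G]` sent for the message `m` and the auxiliary message `m'`. -/
def CosetCode.encode {k κ n : ℕ} (C : CosetCode k κ n) (m : BVec k) (m' : BVec κ) : BVec n :=
  Matrix.vecMul (Sum.elim m m') (Matrix.fromRows C.G' C.G)

/-- Transition probabilities of the binary erasure channel with erasure probability `ε`; the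
output `none` is the erasure symbol. -/
def becProb (ε : ℝ) (x : ZMod 2) : Option (ZMod 2) → ℝ
  | none => ε
  | some y => if y = x then 1 - ε else 0

/-- Words received by the eavesdropper. -/
abbrev Obs (n : ℕ) : Type := Fin n → Option (ZMod 2)

/-- The uniform distribution `p_M` of the message. -/
def pM {k : ℕ} (_m : BVec k) : ℝ := 1 / 2 ^ k

/-- The joint distribution `p_{MZ}` of the message and the eavesdropper's observation: the message
and the auxiliary message are uniform and independent, and the code bits are erased independently
of each other with probability `ε`. -/
def CosetCode.pMZ {k κ n : ℕ} (C : CosetCode k κ n) (ε : ℝ) (m : BVec k) (z : Obs n) : ℝ :=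
  pM m * ∑ m' : BVec κ, (1 / 2 ^ κ) * ∏ i : Fin n, becProb ε (C.encode m m' i) (z i)

/-- The marginal distribution `p_Z` of the eavesdropper's observation. -/
def CosetCode.pZ {k κ n : ℕ} (C : CosetCode k κ n) (ε : ℝ) (z : Obs n) : ℝ :=
  ∑ m : BVec k, C.pMZ ε m z

/-- The `χ²` divergence of `p` from `q`. Points with `q a = 0` contribute `0`. -/
def chiSq {α : Type*} [Fintype α] (p q : α → ℝ) : ℝ :=
  ∑ a : α, (p a / q a - 1) ^ 2 * q a

/-- The `χ²` divergence `λ` between `p_{MZ}` and `p_M p_Z` at erasure probability `ε`. -/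
def CosetCode.chiSqDiv {k κ n : ℕ} (C : CosetCode k κ n) (ε : ℝ) : ℝ :=
  chiSq (fun a : BVec k × Obs n => C.pMZ ε a.1 a.2)
    (fun a : BVec k × Obs n => pM a.1 * C.pZ ε a.2)

/-- The probability that a maximum likelihood decoder of the eavesdropper recovers the message. -/
def CosetCode.mlSuccess {k κ n : ℕ} (C : CosetCode k κ n) (ε : ℝ) : ℝ :=
  ∑ z : Obs n, ⨆ m : BVec k, C.pMZ ε m z

/-- Code definition vectors, indexed by the vectors of `W`, with the Euclidean norm. -/
abbrev CodeVec (κ : ℕ) : Type := EuclideanSpace ℝ (BVec κ)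

/-- The code definition vector of a generator matrix: the entry at `v` is the fraction of the
columns that are equal to `v`. -/
def codeVec {κ n : ℕ} (G : Matrix (Fin κ) (Fin n) (ZMod 2)) : CodeVec κ :=
  WithLp.toLp 2 fun v => ((Finset.univ.filter fun j : Fin n => (fun i => G i j) = v).card : ℝ) / n

/-- The uniform vector fraction code: all nonzero columns in equal proportions. -/
def uniformVec (κ : ℕ) : CodeVec κ :=
  WithLp.toLp 2 fun v => if v = 0 then 0 else 1 / (2 ^ κ - 1)

open Classical in
/-- The subspace exclusion code that excludes the subspace `U`: all columns outside `U` in equal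
proportions. -/
def secVec {κ : ℕ} (U : Submodule (ZMod 2) (BVec κ)) : CodeVec κ :=
  WithLp.toLp 2 fun v =>
    if v ∈ U then 0 else 1 / (2 ^ κ - 2 ^ Module.finrank (ZMod 2) U)

/-- The canonical subspace of dimension `u` (for `u ≤ κ`): the binary expansions, least
significant bit first, of the numbers below `2 ^ u`. -/
def canonicalSubspace (κ u : ℕ) : Submodule (ZMod 2) (BVec κ) where
  carrier := {v | ∀ i : Fin κ, u ≤ (i : ℕ) → v i = 0}
  add_mem' := by
    intro a b ha hb i hi
    simp [ha i hi, hb i hi]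
  zero_mem' := by
    intro i _
    rfl
  smul_mem' := by
    intro c a ha i hi
    simp [ha i hi]

/-- The canonical subspace exclusion code vector for the dimension `u`. -/
def canonicalSecVec (κ u : ℕ) : CodeVec κ := secVec (canonicalSubspace κ u)

/-- A code definition vector without the all-zero column that satisfies the nonnegativity and the
unit-sum constraints. -/
structure IsCodeDef {κ : ℕ} (q : CodeVec κ) : Prop where
  zero_col : q 0 = 0
  nonneg : ∀ v, 0 ≤ q v
  unit_sum : ∑ v, q v = 1

/-- The realizability constraint for blocklength `n`. -/
def IsRealizable {κ : ℕ} (n : ℕ) (q : CodeVec κ) : Prop :=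
  ∀ v, ∃ N : ℕ, (n : ℝ) * q v = N

/-- The radius constraint: `q` is as far from the uniform vector fraction code as the subspace
exclusion code for the dimension `u`. -/
def RadiusConstraint {κ : ℕ} (u : ℕ) (q : CodeVec κ) : Prop :=
  ‖q - uniformVec κ‖ = ‖canonicalSecVec κ u - uniformVec κ‖

/-- The constraint on the minimum distance from the first subspace exclusion codes, that is, those
that exclude a subspace of dimension `κ - 1`. -/
def MinDistConstraint {κ : ℕ} (u : ℕ) (q : CodeVec κ) : Prop :=
  ∀ S : Submodule (ZMod 2) (BVec κ), Module.finrank (ZMod 2) S = κ - 1 →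
    ‖canonicalSecVec κ u - canonicalSecVec κ (κ - 1)‖ ≤ ‖q - secVec S‖

end

/-! By linearity, all messages compatible with an observation have the same joint probability with
it. Hence the ML success probability is a constant times the weight enumerator ∑ₓ (2-ε)^(n-wt(xG))
ε^(wt(xG)), and the χ² divergence is an increasing affine function of it (`mlSuccess_eq`,
`chiSqDiv_eq`). It remains to minimize this `energy`.

Let T(v) be 1 minus the multiplicity of the column v, with mass L = 2^κ - n = 2^u. For x ≠ 0 its
Walsh transform is τ(x) = 2 wt(xG) - n, so minimizing `energy` means minimizing ∑ₓ exp(-aτ(x)) for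
some a ≥ 0. If T is the indicator of a subspace, τ takes only the values 0 and L. For general T,
exp(-at) is bounded below by a function of t that agrees with it at 0 and L: a quadratic up to L, a
chord line beyond (`sum_exp_walsh_ge`). The sum of this minorant is controlled by the first moment
of τ and by `sum_walsh_mul_sub_nonneg`, where the integrality of T enters.

For the second claim, the radius constraint fixes ∑ q_v² = 1/n. Realizability then forces n q_v ∈
{0, 1}, which bounds the inner product of q with every subspace exclusion vector by 1/n; nested
subspaces attain this bound. -/

open Finset

/-! ### Characters and the Walsh transform -/

/-- The nontrivial real character of `ZMod 2`. -/
def binSign (a : ZMod 2) : ℝ := if a = 0 then 1 else -1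

@[simp] lemma binSign_zero : binSign 0 = 1 := by simp [binSign]

@[simp] lemma binSign_one : binSign 1 = -1 := by simp [binSign]

lemma ZMod.two_cases (a : ZMod 2) : a = 0 ∨ a = 1 := by
  revert a; decide

lemma binSign_add (a b : ZMod 2) : binSign (a + b) = binSign a * binSign b := by
  have h : (1 + 1 : ZMod 2) = 0 := by decide
  rcases ZMod.two_cases a with rfl | rfl <;> rcases ZMod.two_cases b with rfl | rfl <;>
    simp [h]

/-- A character sum over a subspace that is not annihilated by `x` vanishes. -/
lemma sum_binSign_eq_zero {κ : ℕ} (s : Finset (BVec κ)) (x w : BVec κ) (hw : x ⬝ᵥ w = 1)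
    (hs : ∀ v, v ∈ s ↔ v + w ∈ s) : ∑ v ∈ s, binSign (x ⬝ᵥ v) = 0 := by
  have h : ∑ v ∈ s, binSign (x ⬝ᵥ (v + w)) = ∑ v ∈ s, binSign (x ⬝ᵥ v) :=
    Finset.sum_equiv (Equiv.addRight w) (by simpa using hs) (by simp)
  simp only [dotProduct_add, hw, binSign_add, binSign_one] at h
  rw [← Finset.sum_mul] at h
  linarith

lemma exists_dotProduct_eq_one {κ : ℕ} {v : BVec κ} (hv : v ≠ 0) : ∃ x : BVec κ, v ⬝ᵥ x = 1 := by
  obtain ⟨i, hi⟩ := Function.ne_iff.mp hv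
  exact ⟨Pi.single i 1, by simpa using (ZMod.two_cases (v i)).resolve_left hi⟩

lemma sum_binSign {κ : ℕ} (v : BVec κ) :
    ∑ x : BVec κ, binSign (x ⬝ᵥ v) = if v = 0 then 2 ^ κ else 0 := by
  split_ifs with h
  · simp [h, ZMod.card]
  · obtain ⟨w, hw⟩ := exists_dotProduct_eq_one h
    simpa only [dotProduct_comm v] using sum_binSign_eq_zero univ v w hw (by simp)

/-- The Walsh–Hadamard transform. -/
def walsh {κ : ℕ} (T : BVec κ → ℝ) (x : BVec κ) : ℝ := ∑ v, T v * binSign (x ⬝ᵥ v)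

lemma sum_walsh {κ : ℕ} (T : BVec κ → ℝ) : ∑ x, walsh T x = 2 ^ κ * T 0 := by
  unfold walsh
  rw [Finset.sum_comm]
  simp only [← Finset.mul_sum, sum_binSign]
  simp [mul_comm]

lemma sum_walsh_sq {κ : ℕ} (T : BVec κ → ℝ) : ∑ x, walsh T x ^ 2 = 2 ^ κ * ∑ v, T v ^ 2 := by
  have h (x : BVec κ) : walsh T x ^ 2 = ∑ v, ∑ w, T v * T w * binSign (x ⬝ᵥ (v + w)) := by
    rw [sq, walsh, Finset.sum_mul_sum]
    refine Finset.sum_congr rfl fun v _ => Finset.sum_congr rfl fun w _ => ?_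
    rw [dotProduct_add, binSign_add]
    ring
  have h2 (v w : BVec κ) : v + w = 0 ↔ v = w := by
    rw [add_eq_zero_iff_eq_neg, ZModModule.neg_eq_self]
  simp only [h]
  rw [Finset.sum_comm, Finset.mul_sum]
  refine Finset.sum_congr rfl fun v _ => ?_
  rw [Finset.sum_comm]
  simp only [← Finset.mul_sum, sum_binSign, h2]
  simp
  ring

/-! ### Minorants of the exponential function -/

/-- Taylor's formula for the exponential function with the remainder as an integral. -/
lemma exp_neg_remainder (y : ℝ) :
    Real.exp (-y) - 1 + y = y ^ 2 * ∫ s in (0 : ℝ)..1, (1 - s) * Real.exp (-(y * s)) := by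
  have h (s : ℝ) : HasDerivAt (fun s => (1 - y * (1 - s)) * Real.exp (-(y * s)))
      (y ^ 2 * ((1 - s) * Real.exp (-(y * s)))) s := by
    have h1 : HasDerivAt (fun s : ℝ => 1 - y * (1 - s)) y s := by
      simpa using (((hasDerivAt_id s).const_sub 1).const_mul y).const_sub 1
    have h2 : HasDerivAt (fun s : ℝ => -(y * s)) (-y) s := by
      simpa using (hasDerivAt_id s).const_mul (-y)
    exact (h1.mul h2.exp).congr_deriv (by ring)
  rw [← intervalIntegral.integral_const_mul,
    intervalIntegral.integral_eq_sub_of_hasDerivAt (fun s _ => h s)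
      (Continuous.intervalIntegrable (by fun_prop) _ _)]
  simp
  ring

/-- The integral in `exp_neg_remainder` decreases in y on the whole real line; compare y = at with y
= aL. Negative t must be covered, since Walsh values can be negative. -/
lemma quadratic_le_exp_neg {a L t : ℝ} (ha : 0 ≤ a) (hL : 0 < L) (ht : t ≤ L) :
    1 - a * t + (Real.exp (-(a * L)) - 1 + a * L) / L ^ 2 * t ^ 2 ≤ Real.exp (-(a * t)) := by
  have h : (∫ s in (0 : ℝ)..1, (1 - s) * Real.exp (-(a * L * s))) ≤
      ∫ s in (0 : ℝ)..1, (1 - s) * Real.exp (-(a * t * s)) := by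
    refine intervalIntegral.integral_mono_on zero_le_one
      (Continuous.intervalIntegrable (by fun_prop) _ _)
      (Continuous.intervalIntegrable (by fun_prop) _ _) fun s hs => ?_
    have : a * t * s ≤ a * L * s :=
      mul_le_mul_of_nonneg_right (mul_le_mul_of_nonneg_left ht ha) hs.1
    exact mul_le_mul_of_nonneg_left (Real.exp_le_exp.mpr (neg_le_neg this)) (sub_nonneg.mpr hs.2)
  have h1 := exp_neg_remainder (a * L)
  have h2 := exp_neg_remainder (a * t)
  rw [h1, mul_pow, mul_right_comm, mul_div_assoc, div_self (by positivity), mul_one]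
  have := mul_le_mul_of_nonneg_left h (sq_nonneg (a * t))
  nlinarith

/-- By convexity, the chord over [0, L] extended to the right of L stays below the graph. -/
lemma chord_le_exp_neg {a L t : ℝ} (hL : 0 < L) (ht : L ≤ t) :
    1 + (Real.exp (-(a * L)) - 1) / L * t ≤ Real.exp (-(a * t)) := by
  have hc := convexOn_exp.2 (Set.mem_univ 0) (Set.mem_univ (-(a * t)))
    (sub_nonneg.mpr ((div_le_one (hL.trans_le ht)).mpr ht)) (div_nonneg hL.le (hL.le.trans ht))
    (by ring)
  have ht0 : 0 < t := hL.trans_le ht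
  have e : (1 - L / t) • (0 : ℝ) + (L / t) • (-(a * t)) = -(a * L) := by
    simp only [smul_eq_mul]
    field_simp
    ring
  rw [e] at hc
  simp only [smul_eq_mul, Real.exp_zero] at hc
  have h1 : Real.exp (-(a * L)) - 1 ≤ L / t * (Real.exp (-(a * t)) - 1) := by linarith
  have h2 : (Real.exp (-(a * L)) - 1) / L * t ≤ (L / t * (Real.exp (-(a * t)) - 1)) / L * t := by
    gcongr
  have h3 : (L / t * (Real.exp (-(a * t)) - 1)) / L * t = Real.exp (-(a * t)) - 1 := by
    field_simp
  linarith

/-! ### The lower bound for exponential sums of Walsh values -/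

/-- For an integer-valued function with `T 0 ≤ 1` and mass `L`, the values of the Walsh transform
up to `L` satisfy the second moment bound. -/
lemma sum_walsh_mul_sub_nonneg {κ : ℕ} {L : ℝ} (hL : 0 < L) (T : BVec κ → ℤ) (h0 : T 0 ≤ 1)
    (hT : ∑ v, (T v : ℝ) = L) :
    0 ≤ ∑ x with walsh (fun v => (T v : ℝ)) x ≤ L,
      walsh (fun v => (T v : ℝ)) x * (walsh (fun v => (T v : ℝ)) x - L) := by
  set τ := walsh (fun v => (T v : ℝ)) with hτ
  have hsum : ∑ x, τ x = 2 ^ κ * (T 0 : ℝ) := sum_walsh _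
  have hsq : ∑ x, τ x ^ 2 = 2 ^ κ * ∑ v, (T v : ℝ) ^ 2 := sum_walsh_sq _
  have hsplit := Finset.sum_filter_add_sum_filter_not univ (fun x => τ x ≤ L) τ
  rw [hsum] at hsplit
  have hbig : 0 ≤ ∑ x with ¬ τ x ≤ L, τ x :=
    Finset.sum_nonneg fun x hx => by
      have := (Finset.mem_filter.mp hx).2
      linarith
  -- If the values above L already exhaust the first moment, those up to L have nonpositive sum, and
  -- both terms of ∑ τ² - L ∑ τ are harmless. Otherwise T 0 is a positive integer, hence 1.
  rcases le_or_gt (2 ^ κ * (T 0 : ℝ)) (∑ x with ¬ τ x ≤ L, τ x) with h | h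
  · have h1 : ∑ x with τ x ≤ L, τ x * (τ x - L) =
        ∑ x with τ x ≤ L, τ x ^ 2 - L * ∑ x with τ x ≤ L, τ x := by
      rw [Finset.mul_sum, ← Finset.sum_sub_distrib]
      exact Finset.sum_congr rfl fun x _ => by ring
    rw [h1]
    have h2 : 0 ≤ ∑ x with τ x ≤ L, τ x ^ 2 := Finset.sum_nonneg fun x _ => sq_nonneg _
    have h3 : ∑ x with τ x ≤ L, τ x ≤ 0 := by linarith
    nlinarith
  · have hT0 : T 0 = 1 := by
      have : (0 : ℝ) < T 0 := by
        by_contra! hc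
        have : (2 : ℝ) ^ κ * (T 0 : ℝ) ≤ 0 :=
          mul_nonpos_of_nonneg_of_nonpos (by positivity) hc
        linarith
      have : 0 < T 0 := by exact_mod_cast this
      omega
    rw [hT0, Int.cast_one, mul_one] at h hsum
    set B := ∑ v, ((T v : ℝ) ^ 2 - T v) with hB
    have hBL : B = ∑ v, (T v : ℝ) ^ 2 - L := by rw [hB, Finset.sum_sub_distrib, hT]
    have hint (z : ℤ) : (0 : ℝ) ≤ (z : ℝ) ^ 2 - z := by
      have : 0 ≤ z ^ 2 - z := by
        rcases le_or_gt z 0 with h | h <;> nlinarith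
      exact_mod_cast this
    have hB0 : 0 ≤ B := Finset.sum_nonneg fun v _ => hint _
    -- Termwise this is 0 ≤ T² - T or -2T ≤ T² - T, both true for integers.
    have hle (x : BVec κ) : τ x - L ≤ B := by
      rw [← hT, hτ, walsh, ← Finset.sum_sub_distrib]
      refine Finset.sum_le_sum fun v _ => ?_
      rcases ZMod.two_cases (x ⬝ᵥ v) with e | e
      · simpa [e] using hint (T v)
      · have := hint (-T v)
        push_cast at this
        rw [e, binSign_one]
        linarith
    -- Parseval, with T 0 = 1. The values above L contribute at most B times their sum, which is
    -- less than 2^κ B, so the others contribute a nonnegative amount.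
    have hall : ∑ x, τ x * (τ x - L) = 2 ^ κ * B := by
      rw [hBL, mul_sub, ← hsq, ← hsum, Finset.sum_mul, ← Finset.sum_sub_distrib]
      exact Finset.sum_congr rfl fun x _ => by ring
    have hX : ∑ x with ¬ τ x ≤ L, τ x * (τ x - L) ≤ (∑ x with ¬ τ x ≤ L, τ x) * B := by
      rw [Finset.sum_mul]
      refine Finset.sum_le_sum fun x hx => mul_le_mul_of_nonneg_left (hle x) ?_
      have := (Finset.mem_filter.mp hx).2
      linarith
    have hs := Finset.sum_filter_add_sum_filter_not univ (fun x => τ x ≤ L)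
      (fun x => τ x * (τ x - L))
    have := mul_le_mul_of_nonneg_right h.le hB0
    linarith

/-- The minorant is 1 + mt, plus pt(t - L) for t ≤ L. Since m ≤ 0 and p ≥ 0, the bounds T 0 ≤ 1 on
the first moment and `sum_walsh_mul_sub_nonneg` on the quadratic part both act in the right
direction. -/
lemma sum_exp_walsh_ge {κ : ℕ} {a L : ℝ} (ha : 0 ≤ a) (hL : 0 < L) (T : BVec κ → ℤ)
    (h0 : T 0 ≤ 1) (hT : ∑ v, (T v : ℝ) = L) :
    2 ^ κ * (1 + (Real.exp (-(a * L)) - 1) / L) ≤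
      ∑ x, Real.exp (-(a * walsh (fun v => (T v : ℝ)) x)) := by
  have key := sum_walsh_mul_sub_nonneg hL T h0 hT
  set τ := walsh (fun v => (T v : ℝ)) with hτ
  have hsum : ∑ x, τ x = 2 ^ κ * (T 0 : ℝ) := sum_walsh _
  set m := (Real.exp (-(a * L)) - 1) / L with hm
  set p := (Real.exp (-(a * L)) - 1 + a * L) / L ^ 2 with hp
  -- The quadratic 1 + mt + pt(t - L) is tangent to exp(-at) at 0.
  have hmp : m - p * L = -a := by
    rw [hm, hp]
    field_simp
    ring
  have hp0 : 0 ≤ p := div_nonneg (by linarith [Real.add_one_le_exp (-(a * L))]) (by positivity)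
  have hm0 : m ≤ 0 := div_nonpos_of_nonpos_of_nonneg
    (by
      have : Real.exp (-(a * L)) ≤ 1 := Real.exp_le_one_iff.mpr (by nlinarith)
      linarith) hL.le
  have hpt (x : BVec κ) : 1 + m * τ x + (if τ x ≤ L then p * (τ x * (τ x - L)) else 0) ≤
      Real.exp (-(a * τ x)) := by
    split_ifs with h
    · have h1 := quadratic_le_exp_neg ha hL h
      rw [← hp] at h1
      have h2 : 1 + m * τ x + p * (τ x * (τ x - L)) = 1 - a * τ x + p * τ x ^ 2 := by
        linear_combination τ x * hmp
      rwa [h2]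
    · rw [add_zero]
      exact chord_le_exp_neg hL (not_le.mp h).le
  have h1 := Finset.sum_le_sum fun x (_ : x ∈ univ) => hpt x
  rw [Finset.sum_add_distrib, Finset.sum_add_distrib, ← Finset.mul_sum, hsum,
    ← Finset.sum_filter, ← Finset.mul_sum] at h1
  have h2 : ∑ _x : BVec κ, (1 : ℝ) = 2 ^ κ := by simp [ZMod.card]
  rw [h2] at h1
  have h3 : m ≤ m * T 0 := by
    have : (T 0 : ℝ) ≤ 1 := by exact_mod_cast h0
    nlinarith
  have h4 := mul_le_mul_of_nonneg_left h3 (by positivity : (0 : ℝ) ≤ 2 ^ κ)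
  have h5 := mul_nonneg hp0 key
  linarith

/-! ### From the wiretap channel to the weight enumerator -/

lemma becProb_nonneg {ε : ℝ} (h0 : 0 ≤ ε) (h1 : ε ≤ 1) (x : ZMod 2) (o : Option (ZMod 2)) :
    0 ≤ becProb ε x o := by
  cases o with
  | none => exact h0
  | some y =>
    simp only [becProb]
    split_ifs <;> linarith

lemma sum_becProb (ε : ℝ) (x : ZMod 2) : ∑ o, becProb ε x o = 1 := by
  rw [Fintype.sum_option]
  simp [becProb]

/-- Translating the sent bit by the received one. -/
lemma becProb_add {ε : ℝ} {x y : ZMod 2} {o : Option (ZMod 2)} (h : ∀ b, o = some b → b = x) :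
    becProb ε (x + y) o = becProb ε y (o.map fun _ => 0) := by
  cases o with
  | none => rfl
  | some b =>
    obtain rfl := h b rfl
    simp [becProb, eq_comm]

namespace CosetCode

variable {k κ n : ℕ} (C : CosetCode k κ n)

/-- The joint probability of an observation and a message that is compatible with it. -/
noncomputable def compatProb (ε : ℝ) (z : Obs n) : ℝ :=
  1 / 2 ^ k * ∑ m' : BVec κ, (1 / 2 ^ κ) *
    ∏ i : Fin n, becProb ε (Matrix.vecMul m' C.G i) ((z i).map fun _ => 0)

/-- The observation `z` can arise from the message `m`. -/
def Compat (m : BVec k) (z : Obs n) : Prop :=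
  ∃ m' : BVec κ, ∀ i b, z i = some b → b = C.encode m m' i

lemma encode_eq (m : BVec k) (m' : BVec κ) :
    C.encode m m' = Matrix.vecMul m C.G' + Matrix.vecMul m' C.G := by
  rw [encode, Matrix.vecMul_fromRows]
  simp

lemma encode_surjective (x : BVec n) : ∃ m m', C.encode m m' = x := by
  have h := C.linInd.span_eq_top_of_card_eq_finrank' (by simp [C.size])
  have hx : x ∈ Submodule.span (ZMod 2)
      (Set.range fun i => Matrix.fromRows C.G' C.G i) := by
    rw [h]
    trivial
  obtain ⟨c, hc⟩ := (Submodule.mem_span_range_iff_exists_fun _).mp hx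
  refine ⟨fun i => c (Sum.inl i), fun i => c (Sum.inr i), ?_⟩
  rw [encode, Matrix.vecMul_eq_sum, ← hc]
  simp [Fintype.sum_sum_type]

lemma exists_compat (z : Obs n) : ∃ m, C.Compat m z := by
  obtain ⟨m, m', h⟩ := C.encode_surjective fun i => (z i).getD 0
  exact ⟨m, m', fun i b hb => by simp [h, hb]⟩

lemma compatProb_nonneg {ε : ℝ} (h0 : 0 ≤ ε) (h1 : ε ≤ 1) (z : Obs n) :
    0 ≤ C.compatProb ε z :=
  mul_nonneg (by positivity) (Finset.sum_nonneg fun _ _ => mul_nonneg (by positivity)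
    (Finset.prod_nonneg fun _ _ => becProb_nonneg h0 h1 _ _))

open Classical in
-- Translating the auxiliary message by a compatible one replaces the received bits by zeros, which
-- removes the dependence on m.
lemma pMZ_eq (ε : ℝ) (m : BVec k) (z : Obs n) :
    C.pMZ ε m z = if C.Compat m z then C.compatProb ε z else 0 := by
  rw [pMZ, pM, compatProb]
  split_ifs with h
  · obtain ⟨m₀, h⟩ := h
    congr 1
    rw [← Equiv.sum_comp (Equiv.addLeft m₀)]
    refine Finset.sum_congr rfl fun m' _ => ?_
    congr 1
    refine Finset.prod_congr rfl fun i _ => ?_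
    rw [← becProb_add (h i), encode_eq, encode_eq, Equiv.coe_addLeft, Matrix.add_vecMul,
      ← add_assoc]
    rfl
  · rw [Finset.sum_eq_zero, mul_zero]
    intro m' _
    simp only [Compat, not_exists, not_forall] at h
    obtain ⟨i, b, hb, hne⟩ := h m'
    rw [Finset.prod_eq_zero (Finset.mem_univ i), mul_zero]
    simp [hb, becProb, hne]

lemma pMZ_nonneg {ε : ℝ} (h0 : 0 ≤ ε) (h1 : ε ≤ 1) (m : BVec k) (z : Obs n) :
    0 ≤ C.pMZ ε m z := by
  rw [pMZ_eq]
  split_ifs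
  exacts [C.compatProb_nonneg h0 h1 z, le_rfl]

lemma sum_pM : ∑ m : BVec k, pM m = 1 := by
  simp [pM, ZMod.card]

lemma sum_pZ (ε : ℝ) : ∑ z, C.pZ ε z = 1 := by
  have h (x : BVec n) : ∑ z : Obs n, ∏ i, becProb ε (x i) (z i) = 1 := by
    have := Finset.prod_univ_sum (fun _ : Fin n => (univ : Finset (Option (ZMod 2))))
      (fun i o => becProb ε (x i) o)
    rw [Fintype.piFinset_univ] at this
    rw [← this]
    simp only [sum_becProb, Finset.prod_const_one]
  simp only [pZ, pMZ]
  rw [Finset.sum_comm]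
  simp only [← Finset.mul_sum]
  have h' (m : BVec k) : ∑ z : Obs n, ∑ m' : BVec κ,
      ∏ i, becProb ε (C.encode m m' i) (z i) = 2 ^ κ := by
    rw [Finset.sum_comm]
    simp [h, ZMod.card]
  simp only [h']
  simp [sum_pM]

lemma mlSuccess_eq_sum {ε : ℝ} (h0 : 0 ≤ ε) (h1 : ε ≤ 1) :
    C.mlSuccess ε = ∑ z, C.compatProb ε z := by
  refine Finset.sum_congr rfl fun z _ => le_antisymm (ciSup_le fun m => ?_) ?_
  · rw [pMZ_eq]
    split_ifs
    exacts [le_rfl, C.compatProb_nonneg h0 h1 z]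
  · obtain ⟨m, hm⟩ := C.exists_compat z
    refine le_trans ?_ (le_ciSup (Set.finite_range _).bddAbove m)
    rw [pMZ_eq, if_pos hm]

lemma compatProb_le_pZ {ε : ℝ} (h0 : 0 ≤ ε) (h1 : ε ≤ 1) (z : Obs n) :
    C.compatProb ε z ≤ C.pZ ε z := by
  obtain ⟨m, hm⟩ := C.exists_compat z
  calc C.compatProb ε z = C.pMZ ε m z := by rw [pMZ_eq, if_pos hm]
    _ ≤ C.pZ ε z := Finset.single_le_sum (f := fun m => C.pMZ ε m z)
        (fun m _ => C.pMZ_nonneg h0 h1 m z) (Finset.mem_univ m)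

lemma chiSqDiv_eq {ε : ℝ} (h0 : 0 ≤ ε) (h1 : ε ≤ 1) :
    C.chiSqDiv ε = 2 ^ k * C.mlSuccess ε - 1 := by
  have hz (z : Obs n) : ∑ m, (C.pMZ ε m z / (pM m * C.pZ ε z) - 1) ^ 2 * (pM m * C.pZ ε z) =
      2 ^ k * C.compatProb ε z - C.pZ ε z := by
    -- Here `compatProb` vanishes too, in agreement with the convention that such terms are 0.
    rcases eq_or_ne (C.pZ ε z) 0 with h | h
    · have := C.compatProb_le_pZ h0 h1 z
      rw [h] at this
      simp [h, le_antisymm this (C.compatProb_nonneg h0 h1 z)]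
    · have hm (m : BVec k) :
          (C.pMZ ε m z / (pM m * C.pZ ε z) - 1) ^ 2 * (pM m * C.pZ ε z) =
            2 ^ k * C.compatProb ε z / C.pZ ε z * C.pMZ ε m z - 2 * C.pMZ ε m z +
              pM m * C.pZ ε z := by
        -- As a function of m, the joint probability takes only the values `compatProb` and 0; this
        -- makes the divergence linear in `compatProb`.
        have hp : C.pMZ ε m z ^ 2 = C.compatProb ε z * C.pMZ ε m z := by
          rw [pMZ_eq]
          split_ifs <;> ring
        have hM : pM m = 1 / 2 ^ k := rfl
        rw [hM]
        field_simp
        linear_combination (2 ^ k) ^ 2 * hp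
      simp only [hm]
      rw [Finset.sum_add_distrib, Finset.sum_sub_distrib, ← Finset.mul_sum, ← Finset.mul_sum,
        ← Finset.sum_mul, sum_pM]
      change _ * C.pZ ε z - 2 * C.pZ ε z + _ = _
      field_simp
      ring
  rw [chiSqDiv, chiSq, Fintype.sum_prod_type, Finset.sum_comm]
  simp only [hz]
  rw [Finset.sum_sub_distrib, sum_pZ, ← Finset.mul_sum, mlSuccess_eq_sum C h0 h1]

/-- The weight enumerator of the base code at `(2 - ε, ε)`. -/
noncomputable def energy (ε : ℝ) : ℝ :=
  ∑ x : BVec κ, ∏ i, if Matrix.vecMul x C.G i = 0 then 2 - ε else ε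

lemma mlSuccess_eq {ε : ℝ} (h0 : 0 ≤ ε) (h1 : ε ≤ 1) :
    C.mlSuccess ε = 1 / 2 ^ k * (1 / 2 ^ κ * C.energy ε) := by
  rw [mlSuccess_eq_sum C h0 h1]
  simp only [compatProb, energy]
  rw [← Finset.mul_sum, Finset.sum_comm]
  congr 1
  rw [Finset.mul_sum]
  refine Finset.sum_congr rfl fun x _ => ?_
  rw [← Finset.mul_sum]
  congr 1
  have := Finset.prod_univ_sum (fun _ : Fin n => (univ : Finset (Option (ZMod 2))))
    (fun i o => becProb ε (Matrix.vecMul x C.G i) (o.map fun _ => 0))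
  rw [Fintype.piFinset_univ] at this
  rw [← this]
  -- The sum over z factors over coordinates. A zero code bit gives ε + 2(1-ε), as both unerased
  -- symbols are mapped to 0; a one gives ε.
  refine Finset.prod_congr rfl fun i _ => ?_
  rw [Fintype.sum_option]
  simp only [Option.map_none, Option.map_some, becProb, eq_comm (a := (0 : ZMod 2))]
  split_ifs
  · simp [ZMod.card]
    ring
  · simp

end CosetCode

/-! ### The weight enumerator in terms of Walsh values -/

/-- One minus the number of columns of a generator matrix that are equal to `v`. -/
def columnDefect {κ n : ℕ} (G : Matrix (Fin κ) (Fin n) (ZMod 2)) (v : BVec κ) : ℤ :=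
  1 - ((univ.filter fun j : Fin n => (fun i => G i j) = v).card : ℤ)

lemma columnDefect_le_one {κ n : ℕ} (G : Matrix (Fin κ) (Fin n) (ZMod 2)) (v : BVec κ) :
    columnDefect G v ≤ 1 := by
  simp [columnDefect]

lemma sum_columnDefect_mul {κ n : ℕ} (G : Matrix (Fin κ) (Fin n) (ZMod 2)) (f : BVec κ → ℝ) :
    ∑ v, (columnDefect G v : ℝ) * f v = ∑ v, f v - ∑ j, f fun i => G i j := by
  rw [← Finset.sum_fiberwise univ (fun j i => G i j) (fun j => f fun i => G i j),
    ← Finset.sum_sub_distrib]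
  refine Finset.sum_congr rfl fun v _ => ?_
  have : ∑ j with (fun i => G i j) = v, f (fun i => G i j) =
      ∑ j with (fun i => G i j) = v, f v :=
    Finset.sum_congr rfl fun j hj => by rw [(Finset.mem_filter.mp hj).2]
  rw [this, Finset.sum_const, nsmul_eq_mul]
  simp only [columnDefect]
  push_cast
  ring

lemma sum_columnDefect {κ n : ℕ} (G : Matrix (Fin κ) (Fin n) (ZMod 2)) :
    ∑ v, (columnDefect G v : ℝ) = 2 ^ κ - n := by
  simpa [ZMod.card] using sum_columnDefect_mul G fun _ => 1

lemma walsh_columnDefect {κ n : ℕ} (G : Matrix (Fin κ) (Fin n) (ZMod 2)) {x : BVec κ}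
    (hx : x ≠ 0) : walsh (fun v => (columnDefect G v : ℝ)) x =
      -∑ j, binSign (Matrix.vecMul x G j) := by
  have h := sum_binSign x
  rw [if_neg hx] at h
  simp only [dotProduct_comm _ x] at h
  rw [walsh, sum_columnDefect_mul, h, zero_sub]
  rfl

namespace CosetCode

variable {k κ n : ℕ}

/-- The term x = 0 is split off because the Walsh value there is 2^κ - n instead of -n. Both
corrections are the same for all codes of the given size. -/
lemma energy_eq (C : CosetCode k κ n) {ε : ℝ} (h0 : 0 < ε) (h1 : ε ≤ 1) :
    C.energy ε = (2 - ε) ^ n + Real.exp (n * ((Real.log (2 - ε) + Real.log ε) / 2)) *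
      (∑ x, Real.exp (-((Real.log (2 - ε) - Real.log ε) / 2 *
          walsh (fun v => (columnDefect C.G v : ℝ)) x)) -
        Real.exp (-((Real.log (2 - ε) - Real.log ε) / 2 * (2 ^ κ - n)))) := by
  set a := (Real.log (2 - ε) - Real.log ε) / 2 with ha
  set c := (Real.log (2 - ε) + Real.log ε) / 2 with hc
  have hfac (b : ZMod 2) : (if b = 0 then 2 - ε else ε) = Real.exp (c + a * binSign b) := by
    rcases ZMod.two_cases b with rfl | rfl
    · rw [if_pos rfl, binSign_zero, show c + a * 1 = Real.log (2 - ε) by rw [ha, hc]; ring,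
        Real.exp_log (by linarith)]
    · rw [if_neg (by decide), binSign_one, show c + a * -1 = Real.log ε by rw [ha, hc]; ring,
        Real.exp_log h0]
  have hterm {x : BVec κ} (hx : x ≠ 0) :
      (∏ i, if Matrix.vecMul x C.G i = 0 then 2 - ε else ε) =
        Real.exp (n * c) * Real.exp (-(a * walsh (fun v => (columnDefect C.G v : ℝ)) x)) := by
    simp only [hfac]
    rw [← Real.exp_sum, ← Real.exp_add, walsh_columnDefect C.G hx, Finset.sum_add_distrib,
      ← Finset.mul_sum]
    simp
  have hw0 : walsh (fun v => (columnDefect C.G v : ℝ)) 0 = 2 ^ κ - n := by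
    rw [← sum_columnDefect C.G]
    simp [walsh]
  rw [energy, ← Finset.add_sum_erase _ _ (Finset.mem_univ (0 : BVec κ)),
    ← Finset.add_sum_erase univ (fun x => Real.exp _) (Finset.mem_univ (0 : BVec κ)), hw0,
    add_sub_cancel_left, Finset.mul_sum]
  congr 1
  · simp
  · exact Finset.sum_congr rfl fun x hx => hterm (Finset.ne_of_mem_erase hx)

lemma continuous_energy (C : CosetCode k κ n) : Continuous C.energy := by
  refine continuous_finsetSum _ fun x _ => continuous_finsetProd _ fun i _ => ?_
  split_ifs <;> fun_prop

end CosetCode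

/-! ### Optimality of subspace exclusion codes -/

open Classical in
/-- The Walsh transform of the indicator function of a subspace takes the values zero and the
cardinality of the subspace only. -/
lemma walsh_indicator {κ : ℕ} (U : Submodule (ZMod 2) (BVec κ)) (x : BVec κ) :
    walsh (fun v => if v ∈ U then 1 else 0) x = 0 ∨
      walsh (fun v => if v ∈ U then 1 else 0) x = ∑ v, if v ∈ U then 1 else 0 := by
  have h : walsh (fun v => if v ∈ U then 1 else 0) x =
      ∑ v with v ∈ U, binSign (x ⬝ᵥ v) := by
    rw [walsh, Finset.sum_filter]
    exact Finset.sum_congr rfl fun v _ => by split_ifs <;> simp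
  by_cases hx : ∃ w ∈ U, x ⬝ᵥ w = 1
  · obtain ⟨w, hw, hxw⟩ := hx
    left
    rw [h]
    refine sum_binSign_eq_zero _ x w hxw fun v => ?_
    simp only [Finset.mem_filter, Finset.mem_univ, true_and]
    exact (Submodule.add_mem_iff_left U hw).symm
  · right
    push Not at hx
    rw [h, Finset.sum_filter]
    refine Finset.sum_congr rfl fun v _ => ?_
    split_ifs with hv
    · rw [(ZMod.two_cases _).resolve_right (hx v hv), binSign_zero]
    · rfl

/-- On {0, L} the exponential is an affine function, so only the first moment matters. This is the
equality case of `sum_exp_walsh_ge`. -/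
lemma sum_exp_walsh_indicator {κ : ℕ} {a L : ℝ} (hL : 0 < L) (T : BVec κ → ℝ) (h0 : T 0 = 1)
    (h : ∀ x, walsh T x = 0 ∨ walsh T x = L) :
    ∑ x, Real.exp (-(a * walsh T x)) = 2 ^ κ * (1 + (Real.exp (-(a * L)) - 1) / L) := by
  have h1 (x : BVec κ) : Real.exp (-(a * walsh T x)) =
      1 + (Real.exp (-(a * L)) - 1) / L * walsh T x := by
    rcases h x with e | e <;> rw [e]
    · simp
    · field_simp
      ring
  simp only [h1]
  rw [Finset.sum_add_distrib, ← Finset.mul_sum, sum_walsh, h0]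
  simp [ZMod.card]
  ring

lemma natCast_two_pow_sub {κ u : ℕ} (hu : u < κ) :
    ((2 ^ κ - 2 ^ u : ℕ) : ℝ) = 2 ^ κ - 2 ^ u := by
  rw [Nat.cast_sub (Nat.pow_le_pow_right two_pos hu.le)]
  simp

lemma two_pow_lt_two_pow {κ u : ℕ} (hu : u < κ) : (2 : ℝ) ^ u < 2 ^ κ :=
  pow_lt_pow_right₀ one_lt_two hu

open Classical in
lemma columnDefect_of_codeVec_eq {κ n u : ℕ} (hu : u < κ) (hn : n = 2 ^ κ - 2 ^ u)
    (G : Matrix (Fin κ) (Fin n) (ZMod 2)) (U : Submodule (ZMod 2) (BVec κ))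
    (hU : Module.finrank (ZMod 2) U = u) (h : codeVec G = secVec U) (v : BVec κ) :
    columnDefect G v = if v ∈ U then 1 else 0 := by
  have hn' : (n : ℝ) = 2 ^ κ - 2 ^ u := by rw [hn, natCast_two_pow_sub hu]
  have hpos : (0 : ℝ) < n := by
    rw [hn']
    linarith [two_pow_lt_two_pow hu]
  have hv := congrArg (fun q : CodeVec κ => q v) h
  simp only [codeVec, secVec, hU, ← hn'] at hv
  rw [columnDefect]
  split_ifs with hvU
  · rw [if_pos hvU, div_eq_zero_iff, or_iff_left hpos.ne'] at hv
    have hv := Nat.cast_eq_zero.mp hv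
    rw [hv]
    simp
  · rw [if_neg hvU, div_left_inj' hpos.ne'] at hv
    have hv := Nat.cast_eq_one.mp hv
    rw [hv]
    simp

lemma CosetCode.energy_le {k κ n u : ℕ} (hu : u < κ) (hn : n = 2 ^ κ - 2 ^ u)
    (U : Submodule (ZMod 2) (BVec κ)) (hU : Module.finrank (ZMod 2) U = u)
    (C C' : CosetCode k κ n) (hC : codeVec C.G = secVec U) {ε : ℝ} (h0 : 0 ≤ ε) (h1 : ε ≤ 1) :
    C.energy ε ≤ C'.energy ε := by
  classical
  have hL : (0 : ℝ) < 2 ^ κ - n := by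
    rw [hn, natCast_two_pow_sub hu]
    simp
  have hpos {ε : ℝ} (h0 : 0 < ε) (h1 : ε ≤ 1) : C.energy ε ≤ C'.energy ε := by
    rw [C.energy_eq h0 h1, C'.energy_eq h0 h1]
    have ha : 0 ≤ (Real.log (2 - ε) - Real.log ε) / 2 := by
      have := Real.log_le_log h0 (by linarith : ε ≤ 2 - ε)
      linarith
    have hT : (fun v => (columnDefect C.G v : ℝ)) = fun v => if v ∈ U then 1 else 0 := by
      funext v
      rw [columnDefect_of_codeVec_eq hu hn C.G U hU hC]
      split_ifs <;> simp
    have hsum := sum_columnDefect C.G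
    rw [hT] at hsum
    have e := sum_exp_walsh_indicator (a := (Real.log (2 - ε) - Real.log ε) / 2) hL
      (fun v => (columnDefect C.G v : ℝ)) (by simp [congrFun hT 0]) fun x => by
        rw [hT, ← hsum]
        exact walsh_indicator U x
    rw [e]
    have := sum_exp_walsh_ge ha hL (columnDefect C'.G) (columnDefect_le_one _ _)
      (sum_columnDefect C'.G)
    gcongr
  -- The logarithmic form is meaningless at ε = 0; this case follows by continuity from the right.
  rcases h0.eq_or_lt with rfl | h0
  · refine le_of_tendsto_of_tendsto
      ((C.continuous_energy.tendsto 0).mono_left (nhdsWithin_le_nhds (s := Set.Ioi 0)))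
      ((C'.continuous_energy.tendsto 0).mono_left (nhdsWithin_le_nhds (s := Set.Ioi 0))) ?_
    filter_upwards [Ioc_mem_nhdsGT (zero_lt_one (α := ℝ))] with ε hε
    exact hpos hε.1 hε.2
  · exact hpos h0 h1

/-! ### Existence of subspace exclusion codes -/

lemma exists_fromRows_linearIndependent {k κ n : ℕ} (hk : k + κ = n)
    (G : Matrix (Fin κ) (Fin n) (ZMod 2)) (hG : LinearIndependent (ZMod 2) fun i => G i) :
    ∃ G' : Matrix (Fin k) (Fin n) (ZMod 2),
      LinearIndependent (ZMod 2) fun i => Matrix.fromRows G' G i := by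
  let S : Submodule (ZMod 2) (BVec n) := Submodule.span (ZMod 2) (Set.range fun i => G i)
  have hfS : Module.finrank (ZMod 2) S = κ := by
    simpa using finrank_span_eq_card hG
  have hQ : Module.finrank (ZMod 2) (BVec n ⧸ S) = k := by
    have := S.finrank_quotient_add_finrank
    rw [hfS, Module.finrank_fin_fun] at this
    omega
  let b := Module.finBasisOfFinrankEq (ZMod 2) (BVec n ⧸ S) hQ
  choose f hf using fun i => Submodule.Quotient.mk_surjective S (b i)
  refine ⟨f, ?_⟩
  have hGS : LinearIndependent (ZMod 2)
      (fun i => (⟨G i, Submodule.subset_span ⟨i, rfl⟩⟩ : S)) :=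
    LinearIndependent.of_comp S.subtype hG
  have h := hGS.sumElim_of_quotient f (by
    rw [show Submodule.Quotient.mk ∘ f = b from funext hf]
    exact b.linearIndependent)
  have hcomm : (fun i => Matrix.fromRows (Matrix.of f) G i) =
      Sum.elim (fun i => G i) f ∘ Equiv.sumComm (Fin k) (Fin κ) := by
    funext i
    rcases i with i | i <;> rfl
  rw [show (fun i => Matrix.fromRows f G i) = _ from hcomm]
  exact h.comp _ (Equiv.sumComm (Fin k) (Fin κ)).injective

lemma exists_cosetCode_of_secVec {k κ n u : ℕ} (hu : u < κ) (hn : n = 2 ^ κ - 2 ^ u)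
    (hk : k + κ = n) (U : Submodule (ZMod 2) (BVec κ)) (hU : Module.finrank (ZMod 2) U = u) :
    ∃ C : CosetCode k κ n, codeVec C.G = secVec U := by
  classical
  have hn' : (n : ℝ) = 2 ^ κ - 2 ^ u := by rw [hn, natCast_two_pow_sub hu]
  have hcard : Fintype.card {v : BVec κ // v ∉ U} = n := by
    have h1 := Module.card_eq_pow_finrank (K := ZMod 2) (V := U)
    rw [hU, ZMod.card] at h1
    rw [Fintype.card_subtype_compl, hn]
    congr 1
    simp [ZMod.card]
  let e := (Fintype.equivFinOfCardEq hcard).symm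
  let G : Matrix (Fin κ) (Fin n) (ZMod 2) := fun i j => (e j).1 i
  have hG : LinearIndependent (ZMod 2) fun i => G i := by
    rw [Fintype.linearIndependent_iff]
    intro x hx
    have hout (v : BVec κ) (hv : v ∉ U) : x ⬝ᵥ v = 0 := by
      have := congrFun hx (e.symm ⟨v, hv⟩)
      simpa [G, dotProduct] using this
    obtain ⟨v₀, hv₀⟩ : ∃ v, v ∉ U := by
      by_contra! h
      have : U = ⊤ := Submodule.eq_top_iff'.mpr h
      rw [this, finrank_top, Module.finrank_fin_fun] at hU
      omega
    by_contra hne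
    have hx0 : x ≠ 0 := fun h => hne fun i => congrFun h i
    obtain ⟨v, hv⟩ := exists_dotProduct_eq_one hx0
    -- The complement of a proper subspace spans: in characteristic 2, v = (v + v₀) + v₀ with both
    -- summands outside U.
    by_cases hvU : v ∈ U
    · have h2 : v + v₀ ∉ U := fun h => hv₀ ((Submodule.add_mem_iff_right U hvU).mp h)
      have := hout _ h2
      rw [dotProduct_add, hv, hout _ hv₀] at this
      exact absurd this (by decide)
    · rw [hout v hvU] at hv
      exact absurd hv (by decide)
  obtain ⟨G', hG'⟩ := exists_fromRows_linearIndependent hk G hG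
  refine ⟨⟨G, G', hk, hG'⟩, ?_⟩
  ext v
  simp only [codeVec, secVec, hU, ← hn']
  have hGj (j : Fin n) : (fun i => G i j) = (e j).1 := rfl
  simp only [hGj]
  split_ifs with hv
  · rw [Finset.filter_false_of_mem]
    · simp
    · rintro j - rfl
      exact (e j).2 hv
  · have : (univ.filter fun j : Fin n => (e j).1 = v) = {e.symm ⟨v, hv⟩} := by
      ext j
      simp [Equiv.eq_symm_apply, Subtype.ext_iff]
    rw [this]
    simp

/-! ### The minimum-distance constraint -/

lemma finrank_canonicalSubspace {κ u : ℕ} (hu : u ≤ κ) :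
    Module.finrank (ZMod 2) (canonicalSubspace κ u) = u := by
  let e : canonicalSubspace κ u ≃ₗ[ZMod 2] (Fin u → ZMod 2) :=
    { toFun := fun v i => v.1 (Fin.castLE hu i)
      map_add' := fun _ _ => rfl
      map_smul' := fun _ _ => rfl
      invFun := fun w => ⟨fun i => if h : (i : ℕ) < u then w ⟨i, h⟩ else 0,
        fun i hi => dif_neg (not_lt.mpr hi)⟩
      left_inv := fun v => by
        ext i
        by_cases h : (i : ℕ) < u
        · simp [h]
        · simpa [h] using (v.2 i (not_lt.mp h)).symm
      right_inv := fun w => by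
        ext i
        simp }
  rw [e.finrank_eq, Module.finrank_fin_fun]

lemma canonicalSubspace_mono (κ : ℕ) {u d : ℕ} (h : u ≤ d) :
    canonicalSubspace κ u ≤ canonicalSubspace κ d :=
  fun _ hv i hi => hv i (h.trans hi)

lemma secVec_nonneg {κ : ℕ} (U : Submodule (ZMod 2) (BVec κ)) (v : BVec κ) :
    0 ≤ secVec U v := by
  simp only [secVec]
  split_ifs
  · exact le_rfl
  · have h : Module.finrank (ZMod 2) U ≤ κ := by
      simpa using Submodule.finrank_le U
    have : (2 : ℝ) ^ Module.finrank (ZMod 2) U ≤ 2 ^ κ :=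
      pow_le_pow_right₀ one_le_two h
    exact one_div_nonneg.mpr (sub_nonneg.mpr this)

lemma isCodeDef_secVec {κ : ℕ} (U : Submodule (ZMod 2) (BVec κ))
    (hU : Module.finrank (ZMod 2) U < κ) : IsCodeDef (secVec U) where
  zero_col := by simp [secVec]
  nonneg := secVec_nonneg U
  unit_sum := by
    classical
    have h1 := Module.card_eq_pow_finrank (K := ZMod 2) (V := U)
    rw [ZMod.card] at h1
    have hc : Fintype.card {v : BVec κ // v ∉ U} = 2 ^ κ - 2 ^ Module.finrank (ZMod 2) U := by
      rw [Fintype.card_subtype_compl]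
      congr 1
      simp [ZMod.card]
    have hne : (2 : ℝ) ^ κ - 2 ^ Module.finrank (ZMod 2) U ≠ 0 :=
      (sub_pos.mpr (two_pow_lt_two_pow hU)).ne'
    have h2 (v : BVec κ) : secVec U v =
        if v ∉ U then 1 / (2 ^ κ - 2 ^ Module.finrank (ZMod 2) U) else 0 := by
      simp only [secVec]
      split_ifs <;> rfl
    simp only [h2]
    rw [← Finset.sum_filter, Finset.sum_const, ← Fintype.card_subtype, hc, nsmul_eq_mul,
      natCast_two_pow_sub hU]
    field_simp

lemma sum_secVec_sq {κ : ℕ} (U : Submodule (ZMod 2) (BVec κ))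
    (hU : Module.finrank (ZMod 2) U < κ) :
    ∑ v, secVec U v ^ 2 = 1 / (2 ^ κ - 2 ^ Module.finrank (ZMod 2) U) := by
  have h (v : BVec κ) : secVec U v ^ 2 =
      1 / (2 ^ κ - 2 ^ Module.finrank (ZMod 2) U) * secVec U v := by
    simp only [secVec]
    split_ifs <;> ring
  simp only [h]
  rw [← Finset.mul_sum, (isCodeDef_secVec U hU).unit_sum, mul_one]

lemma norm_sub_sq_eq_sums {κ : ℕ} (q r : CodeVec κ) :
    ‖q - r‖ ^ 2 = ∑ v, q v ^ 2 - 2 * ∑ v, q v * r v + ∑ v, r v ^ 2 := by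
  rw [EuclideanSpace.real_norm_sq_eq, Finset.mul_sum, ← Finset.sum_sub_distrib,
    ← Finset.sum_add_distrib]
  refine Finset.sum_congr rfl fun v _ => ?_
  simp only [PiLp.sub_apply]
  ring

lemma sum_mul_uniformVec {κ : ℕ} {q : CodeVec κ} (hq : IsCodeDef q) :
    ∑ v, q v * uniformVec κ v = 1 / (2 ^ κ - 1) := by
  have h (v : BVec κ) : q v * uniformVec κ v = q v * (1 / (2 ^ κ - 1)) := by
    simp only [uniformVec]
    split_ifs with hv
    · rw [hv, hq.zero_col]
      ring
    · rfl
  simp only [h]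
  rw [← Finset.sum_mul, hq.unit_sum, one_mul]

/-- All code definition vectors have the same inner product with `uniformVec`, so the radius
determines the norm. -/
lemma sum_sq_eq_of_radiusConstraint {κ u : ℕ} (hu : u < κ) {q : CodeVec κ} (hq : IsCodeDef q)
    (hr : RadiusConstraint u q) : ∑ v, q v ^ 2 = 1 / (2 ^ κ - 2 ^ u) := by
  have hf := finrank_canonicalSubspace hu.le
  have hs := sum_secVec_sq (canonicalSubspace κ u) (by rwa [hf])
  have hd := isCodeDef_secVec (canonicalSubspace κ u) (by rwa [hf])
  rw [hf] at hs
  have h := congrArg (· ^ 2) hr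
  simp only [canonicalSecVec, norm_sub_sq_eq_sums, sum_mul_uniformVec hq,
    sum_mul_uniformVec hd, hs] at h
  linarith

/-- A realizable code definition vector with the least possible sum of squares repeats no
column. -/
lemma le_one_div_of_sum_sq {κ n : ℕ} (hn : 0 < n) {q : CodeVec κ} (hq : IsCodeDef q)
    (hr : IsRealizable n q) (h : ∑ v, q v ^ 2 = 1 / n) (v : BVec κ) : q v ≤ 1 / n := by
  have hn' : (0 : ℝ) < n := by exact_mod_cast hn
  -- These terms are nonnegative by integrality and have sum zero, so every n q_v is 0 or 1.
  have hnn (v : BVec κ) : 0 ≤ (n * q v) ^ 2 - n * q v := by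
    obtain ⟨N, hN⟩ := hr v
    rw [hN]
    have : (N : ℝ) ≤ (N : ℝ) ^ 2 := by exact_mod_cast Nat.le_self_pow two_ne_zero N
    linarith
  have hsum : ∑ v, ((n * q v) ^ 2 - n * q v) = 0 := by
    simp only [mul_pow]
    rw [Finset.sum_sub_distrib, ← Finset.mul_sum, ← Finset.mul_sum, h, hq.unit_sum]
    field_simp
    ring
  have hv := (Finset.sum_eq_zero_iff_of_nonneg fun v _ => hnn v).mp hsum v (Finset.mem_univ v)
  rw [le_div_iff₀ hn']
  nlinarith

lemma minDistConstraint_of_isRealizable {κ n u : ℕ} (hu : u < κ) (hn : n = 2 ^ κ - 2 ^ u)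
    {q : CodeVec κ} (hq : IsCodeDef q) (hr : RadiusConstraint u q) (hz : IsRealizable n q) :
    MinDistConstraint u q := by
  intro S hS
  have hn' : (n : ℝ) = 2 ^ κ - 2 ^ u := by rw [hn, natCast_two_pow_sub hu]
  have hpos : (0 : ℝ) < n := by
    rw [hn']
    linarith [two_pow_lt_two_pow hu]
  have hsq := sum_sq_eq_of_radiusConstraint hu hq hr
  rw [← hn'] at hsq
  have hle := le_one_div_of_sum_sq (by exact_mod_cast hpos) hq hz hsq
  have hfu := finrank_canonicalSubspace hu.le
  have hfd := finrank_canonicalSubspace (Nat.sub_le κ 1)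
  have hlt : κ - 1 < κ := by omega
  have hsu := sum_secVec_sq (canonicalSubspace κ u) (by rwa [hfu])
  rw [hfu, ← hn'] at hsu
  have hsd := sum_secVec_sq (canonicalSubspace κ (κ - 1)) (by rwa [hfd])
  rw [hfd] at hsd
  have hsS := sum_secVec_sq S (by rwa [hS])
  rw [hS] at hsS
  have hin : ∑ v, q v * secVec S v ≤ 1 / n := by
    calc ∑ v, q v * secVec S v ≤ ∑ v, 1 / (n : ℝ) * secVec S v :=
          Finset.sum_le_sum fun v _ => mul_le_mul_of_nonneg_right (hle v) (secVec_nonneg S v)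
      _ = 1 / n := by
          rw [← Finset.mul_sum, (isCodeDef_secVec S (by rwa [hS])).unit_sum, mul_one]
  -- Equality holds because the canonical subspaces are nested: the first vector is constantly 1/n
  -- on the support of the second. With all norms fixed, comparing distances is comparing inner
  -- products.
  have hcan : ∑ v, canonicalSecVec κ u v * canonicalSecVec κ (κ - 1) v = 1 / n := by
    have h (v : BVec κ) : canonicalSecVec κ u v * canonicalSecVec κ (κ - 1) v =
        1 / (n : ℝ) * canonicalSecVec κ (κ - 1) v := by
      simp only [canonicalSecVec, secVec, hfu, ← hn']
      by_cases hv : v ∈ canonicalSubspace κ (κ - 1)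
      · simp [hv]
      · have hv' : v ∉ canonicalSubspace κ u :=
          fun h => hv (canonicalSubspace_mono κ (by omega) h)
        simp [hv, hv']
    simp only [h]
    rw [← Finset.mul_sum, canonicalSecVec, (isCodeDef_secVec _ (by rwa [hfd])).unit_sum, mul_one]
  refine le_of_sq_le_sq ?_ (norm_nonneg _)
  rw [norm_sub_sq_eq_sums, norm_sub_sq_eq_sums, hcan, hsq, hsS]
  rw [canonicalSecVec, canonicalSecVec, hsu, hsd]
  linarith

theorem corollary5 (k κ n u : ℕ) (hu : u < κ) (hn : n = 2 ^ κ - 2 ^ u) (hk : k + κ = n) :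
    -- subspace exclusion codes of this size exist, and each of them is optimal
    (∀ U : Submodule (ZMod 2) (BVec κ), Module.finrank (ZMod 2) U = u →
      (∃ C : CosetCode k κ n, codeVec C.G = secVec U) ∧
      ∀ C : CosetCode k κ n, codeVec C.G = secVec U →
        ∀ C' : CosetCode k κ n, ∀ ε : ℝ, 0 ≤ ε → ε ≤ 1 →
          C.chiSqDiv ε ≤ C'.chiSqDiv ε ∧ C.mlSuccess ε ≤ C'.mlSuccess ε) ∧
    -- the minimum-distance constraint excludes no realizable code definition vector
    (∀ q : CodeVec κ, IsCodeDef q → RadiusConstraint u q → IsRealizable n q →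
      MinDistConstraint u q) := by
  refine ⟨fun U hU => ⟨exists_cosetCode_of_secVec hu hn hk U hU, fun C hC C' ε h0 h1 => ?_⟩,
    fun q hq hr hz => minDistConstraint_of_isRealizable hu hn hq hr hz⟩
  have hml : C.mlSuccess ε ≤ C'.mlSuccess ε := by
    rw [C.mlSuccess_eq h0 h1, C'.mlSuccess_eq h0 h1]
    have := CosetCode.energy_le hu hn U hU C C' hC h0 h1
    gcongr
  refine ⟨?_, hml⟩
  rw [C.chiSqDiv_eq h0 h1, C'.chiSqDiv_eq h0 h1]
  gcongr
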